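/- Let $k$ be an algebraically closed field of characteristic zero, and let $h\in k[x]$ be a monic polynomial of degree $N\ge 1$ whose coefficient at $x^{N-1}$ is zero. Let $A_h$ be the $k$-algebra generated by $x$ and $t$ subject to $tx=xt+h(x)$. Every $w\in A_h$ is uniquely of the form $w=\sum_i w_i(x)t^i$ with $w_i\in k[x]$; $\deg_t(w)$ denotes the largest $i$ with $w_i\ne 0$ (and $-\infty$ if $w=0$). For $w\in A_h$ let $\mathrm{ad}_w(f)=wf-fw$; for $s\in k[x]$ with $\deg s<\deg h$ let $\Delta_s$ be the $k$-derivation of $A_h$ with $\Delta_s(x)=0$, $\Delta_s(t)=s(x)$. For a $k$-derivation $D$ of $A_h$ let $\mathrm{Aut}_D(A_h)=\{\rho\in\mathrm{Aut}_k(A_h) : \rho D=D\rho\}$ be its isotropy group. For $r\in k[x]$ let $\sigma_r$ be the automorphism $x\mapsto x,\ t\mapsto t+r(x)$; for $a\in k^*$ with $h(ax)=a^Nh(x)$ let $\tau_a$ be the automorphism $x\mapsto ax,\ t\mapsto a^{N-1}t$. For $n\ge 1$ write $k[x]\rtimes\mathbb G_n$ for the set of all automorphisms $\sigma_r\circ\tau_a$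 of $A_h$ with $r\in k[x]$ and $a^n=1$. Let $D=\mathrm{ad}_w+\Delta_s$ with $w\in A_h$, $s\in k[x]$, $\deg s<\deg h$. (1) If $\deg_t(w)\ge 2$ and $\mathrm{Aut}_D(A_h)\subseteq k[x]\rtimes\mathbb G_n$ for some $n\ge 1$, then for every $\rho\in\mathrm{Aut}_D(A_h)$ one has $\rho(w)-w\in k$ if and only if $\rho(w)=w$. (2) If $\deg h\ge 2$ and $w$ is not of the form $\alpha t+g(x)$ with $\alpha\in k^*$, $g\in k[x]$ (for example, if $\deg_t(w)\ge 2$), then for every $\rho\in\mathrm{Aut}_D(A_h)$ one has $\rho(w)-w\in k$ if and only if $\rho(w)=w$; moreover $$\mathrm{Aut}_D(A_h)=\{\rho\in\mathrm{Aut}_k(A_h) : \rho(w)=w\}\cap\mathrm{Aut}_{\Delta_s}(A_h),$$ so that for $s=0$ the group $\mathrm{Aut}_D(A_h)$ is exactly the stabilizer of $w$. -/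

import Mathlib

open Polynomial

noncomputable section

namespace DiffOre

/-! ### Derivations and isotropy groups of a (not necessarily commutative) algebra -/

section General

variable (k : Type*) [Field k] (R : Type*) [Ring R] [Algebra k R]

/-- The space of `k`-linear derivations of a possibly noncommutative `k`-algebra `R`. -/
def Der : Submodule k (R →ₗ[k] R) where
  carrier := {D | ∀ f g : R, D (f * g) = D f * g + f * D g}
  add_mem' {D E} hD hE f g := by
    simp only [Set.mem_ofPred_eq] at hD hE
    rw [LinearMap.add_apply, hD, hE, LinearMap.add_apply, LinearMap.add_apply, add_mul, mul_add]
    abel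
  zero_mem' f g := by simp
  smul_mem' c D hD f g := by
    simp only [Set.mem_ofPred_eq] at hD
    rw [LinearMap.smul_apply, hD, LinearMap.smul_apply, LinearMap.smul_apply, smul_add,
      smul_mul_assoc, mul_smul_comm]

variable {k R}

/-- The inner derivation `f ↦ w f - f w`. -/
def innerDer (w : R) : Der k R :=
  ⟨LinearMap.mulLeft k w - LinearMap.mulRight k w, fun f g => by
    simp only [LinearMap.sub_apply, LinearMap.mulLeft_apply, LinearMap.mulRight_apply]
    noncomm_ring⟩

/-- The isotropy group of a derivation `D`: the automorphisms commuting with `D`. -/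
def isotropy (D : Der k R) : Subgroup (R ≃ₐ[k] R) where
  carrier := {ρ | ∀ f : R, ρ (D.1 f) = D.1 (ρ f)}
  mul_mem' {ρ τ} hρ hτ f := by
    simp only [Set.mem_ofPred_eq] at hρ hτ
    rw [AlgEquiv.mul_apply, hτ, hρ, AlgEquiv.mul_apply]
  one_mem' f := rfl
  inv_mem' {ρ} hρ f := by
    simp only [Set.mem_ofPred_eq] at hρ
    apply ρ.injective
    rw [hρ, AlgEquiv.aut_inv, AlgEquiv.apply_symm_apply, AlgEquiv.apply_symm_apply]

end General

/-! ### The algebra generated by `x` and `t` subject to `t x = x t + h(x)` -/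

/-- The two generators. -/
inductive Gen
  | x
  | t

variable {k : Type*} [Field k]

/-- The defining relation `t x = x t + h(x)`. -/
inductive Rel (h : k[X]) : FreeAlgebra k Gen → FreeAlgebra k Gen → Prop
  | comm : Rel h (FreeAlgebra.ι k Gen.t * FreeAlgebra.ι k Gen.x)
      (FreeAlgebra.ι k Gen.x * FreeAlgebra.ι k Gen.t + aeval (FreeAlgebra.ι k Gen.x) h)

/-- The differential Ore extension `A_h = k[x][t; h ∂ₓ]`, as the `k`-algebra generated by `x` and
`t` subject to `t x = x t + h(x)`. -/
def A (h : k[X]) : Type _ := RingQuot (Rel h)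

instance (h : k[X]) : Ring (A h) := inferInstanceAs (Ring (RingQuot (Rel h)))

instance (h : k[X]) : Algebra k (A h) := inferInstanceAs (Algebra k (RingQuot (Rel h)))

section Basic

variable (h : k[X])

/-- The quotient map from the free algebra. -/
def mk : FreeAlgebra k Gen →ₐ[k] A h := RingQuot.mkAlgHom k (Rel h)

/-- The generator `x`. -/
def x : A h := mk h (FreeAlgebra.ι k Gen.x)

/-- The generator `t`. -/
def t : A h := mk h (FreeAlgebra.ι k Gen.t)

/-- The inclusion `k[x] → A_h`. -/
def ofPoly : k[X] →ₐ[k] A h := aeval (x h)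

theorem ofPoly_X : ofPoly h X = x h := by simp [ofPoly]

theorem t_mul_x : t h * x h = x h * t h + ofPoly h h := by
  have := RingQuot.mkAlgHom_rel k (Rel.comm (h := h))
  change mk h _ = mk h _ at this
  rw [map_mul, map_add, map_mul, ← aeval_algHom_apply] at this
  exact this

theorem t_mul_ofPoly (f : k[X]) :
    t h * ofPoly h f = ofPoly h f * t h + ofPoly h (h * derivative f) := by
  induction f using Polynomial.induction_on' with
  | add p q hp hq => simp only [map_add, mul_add, add_mul, hp, hq]; abel
  | monomial n a =>
    induction n generalizing a with
    | zero =>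
      have : ofPoly h (monomial 0 a) = algebraMap k (A h) a := by simp [ofPoly]
      rw [this]; simp [Algebra.commutes]
    | succ n ih =>
      have e : (monomial (n + 1) a : k[X]) = monomial n a * X := by
        rw [monomial_mul_X]
      rw [e, map_mul, ofPoly_X, ← mul_assoc, ih, add_mul, mul_assoc, t_mul_x, derivative_mul,
        derivative_X, mul_add, mul_add, map_add, ← ofPoly_X, mul_assoc, ← map_mul, ← map_mul,
        mul_one, mul_assoc h, mul_comm h (monomial n a)]
      abel

variable {h}

/-- The universal property of `A_h`. -/
def lift {B : Type*} [Ring B] [Algebra k B] (X₀ T₀ : B)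
    (H : T₀ * X₀ = X₀ * T₀ + aeval X₀ h) : A h →ₐ[k] B :=
  RingQuot.liftAlgHom k ⟨FreeAlgebra.lift k (fun g => Gen.casesOn g X₀ T₀), by
    rintro _ _ ⟨⟩
    simp only [map_mul, map_add, FreeAlgebra.lift_ι_apply, ← aeval_algHom_apply]
    exact H⟩

theorem lift_x {B : Type*} [Ring B] [Algebra k B] (X₀ T₀ : B)
    (H : T₀ * X₀ = X₀ * T₀ + aeval X₀ h) : lift X₀ T₀ H (x h) = X₀ := by
  refine (RingQuot.liftAlgHom_mkAlgHom_apply k _ _ _).trans ?_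
  simp

theorem lift_t {B : Type*} [Ring B] [Algebra k B] (X₀ T₀ : B)
    (H : T₀ * X₀ = X₀ * T₀ + aeval X₀ h) : lift X₀ T₀ H (t h) = T₀ := by
  refine (RingQuot.liftAlgHom_mkAlgHom_apply k _ _ _).trans ?_
  simp

theorem hom_ext {B : Type*} [Ring B] [Algebra k B] {φ ψ : A h →ₐ[k] B}
    (hx : φ (x h) = ψ (x h)) (ht : φ (t h) = ψ (t h)) : φ = ψ := by
  refine RingQuot.ringQuot_ext' k _ _ (FreeAlgebra.hom_ext (funext fun g => ?_))
  cases g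
  · exact hx
  · exact ht

theorem lift_ofPoly {B : Type*} [Ring B] [Algebra k B] (X₀ T₀ : B)
    (H : T₀ * X₀ = X₀ * T₀ + aeval X₀ h) (f : k[X]) :
    lift X₀ T₀ H (ofPoly h f) = aeval X₀ f := by
  rw [ofPoly, ← aeval_algHom_apply, lift_x]

/-! ### Normal form and degree in `t` -/

variable (h)

/-- The linear map `∑ gᵢ(x) Tⁱ ↦ ∑ gᵢ(x) tⁱ` from polynomials in `T` over `k[x]` to `A_h`. -/
def ofCoeffs : k[X][X] →ₗ[k] A h :=
  Polynomial.lsum fun i => LinearMap.mulRight k (t h ^ i) ∘ₗ (ofPoly h).toLinearMap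

theorem ofCoeffs_monomial (i : ℕ) (g : k[X]) :
    ofCoeffs h (monomial i g) = ofPoly h g * t h ^ i := by
  simp [ofCoeffs]

theorem ofCoeffs_apply (p : k[X][X]) :
    ofCoeffs h p = ∑ i ∈ p.support, ofPoly h (p.coeff i) * t h ^ i := by
  conv_lhs => rw [p.as_sum_support]
  simp [ofCoeffs_monomial]

/-- The coefficientwise action of `h ∂ₓ` on polynomials in `T` over `k[x]`. -/
def coeffDer : k[X][X] →ₗ[k] k[X][X] :=
  Polynomial.lsum fun i =>
    (monomial i).restrictScalars k ∘ₗ (LinearMap.mulLeft k h ∘ₗ derivative)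

theorem coeffDer_monomial (i : ℕ) (g : k[X]) :
    coeffDer h (monomial i g) = monomial i (h * derivative g) := by
  simp [coeffDer]

/-- Left multiplication by `x` in normal form. -/
def actX : Module.End k k[X][X] := LinearMap.mulLeft k (C X)

/-- Left multiplication by `t` in normal form. -/
def actT : Module.End k k[X][X] := LinearMap.mulLeft k X + coeffDer h

theorem aeval_actX (f : k[X]) : aeval (actX (k := k)) f = LinearMap.mulLeft k (C f) := by
  induction f using Polynomial.induction_on' with
  | add p q hp hq => rw [map_add, hp, hq, C_add]; ext1; simp [add_mul]
  | monomial n a =>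
    ext1 p
    rw [aeval_monomial, actX, LinearMap.pow_mulLeft, Module.End.mul_apply,
      Module.algebraMap_end_apply, LinearMap.mulLeft_apply, LinearMap.mulLeft_apply,
      ← C_mul_X_pow_eq_monomial, C_mul, mul_assoc, C_pow, Algebra.smul_def]
    rfl

theorem act_rel : actT h * actX = actX * actT h + aeval actX h := by
  rw [aeval_actX]
  refine LinearMap.ext fun p => ?_
  induction p using Polynomial.induction_on' with
  | add p q hp hq => rw [map_add, hp, hq, map_add]
  | monomial n g =>
    simp only [actT, actX, Module.End.mul_apply, LinearMap.add_apply, LinearMap.mulLeft_apply,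
      C_mul_monomial, X_mul_monomial, coeffDer_monomial, mul_add, derivative_mul, derivative_X,
      one_mul, map_add]
    rw [mul_left_comm h X]
    abel

/-- The coefficients of an element of `A_h` in its normal form `∑ gᵢ(x) tⁱ`. -/
def toCoeffs : A h →ₗ[k] k[X][X] :=
  LinearMap.applyₗ (1 : k[X][X]) ∘ₗ (lift actX (actT h) (act_rel h)).toLinearMap

theorem toCoeffs_ofCoeffs (p : k[X][X]) : toCoeffs h (ofCoeffs h p) = p := by
  induction p using Polynomial.induction_on' with
  | add p q hp hq => rw [map_add, map_add, hp, hq]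
  | monomial n g =>
    have key : ∀ n : ℕ, (actT h ^ n) (1 : k[X][X]) = monomial n 1 := by
      intro n
      induction n with
      | zero => simp
      | succ n ih =>
        rw [pow_succ', Module.End.mul_apply, ih, actT, LinearMap.add_apply, coeffDer_monomial]
        simp [X_mul_monomial]
    rw [ofCoeffs_monomial]
    simp only [toCoeffs, LinearMap.comp_apply, AlgHom.toLinearMap_apply, LinearMap.applyₗ_apply_apply,
      map_mul, map_pow, lift_t, lift_ofPoly, aeval_actX, Module.End.mul_apply, key]
    simp [C_mul_monomial]

theorem ofCoeffs_actX (p : k[X][X]) : ofCoeffs h (actX p) = x h * ofCoeffs h p := by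
  induction p using Polynomial.induction_on' with
  | add p q hp hq => rw [map_add, map_add, map_add, mul_add, hp, hq]
  | monomial n g =>
    rw [actX, LinearMap.mulLeft_apply, C_mul_monomial, ofCoeffs_monomial, ofCoeffs_monomial,
      map_mul, ofPoly_X, mul_assoc]

theorem ofCoeffs_actT (p : k[X][X]) : ofCoeffs h (actT h p) = t h * ofCoeffs h p := by
  induction p using Polynomial.induction_on' with
  | add p q hp hq => rw [map_add, map_add, map_add, mul_add, hp, hq]
  | monomial n g =>
    rw [actT, LinearMap.add_apply, LinearMap.mulLeft_apply, X_mul_monomial, coeffDer_monomial,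
      map_add, ofCoeffs_monomial, ofCoeffs_monomial, ofCoeffs_monomial, ← mul_assoc (t h),
      t_mul_ofPoly, add_mul, pow_succ', mul_assoc]

theorem ofCoeffs_toCoeffs (w : A h) : ofCoeffs h (toCoeffs h w) = w := by
  have key : ∀ (u : FreeAlgebra k Gen) (p : k[X][X]),
      ofCoeffs h (lift actX (actT h) (act_rel h) (mk h u) p) = mk h u * ofCoeffs h p := by
    intro u
    induction u using FreeAlgebra.induction with
    | grade0 r =>
      intro p
      rw [AlgHom.commutes, AlgHom.commutes, Module.algebraMap_end_apply, map_smul,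
        Algebra.smul_def]
    | grade1 g =>
      intro p
      cases g
      · change ofCoeffs h (lift actX (actT h) (act_rel h) (x h) p) = x h * _
        rw [lift_x, ofCoeffs_actX]
      · change ofCoeffs h (lift actX (actT h) (act_rel h) (t h) p) = t h * _
        rw [lift_t, ofCoeffs_actT]
    | mul a b ha hb => intro p; rw [map_mul, map_mul, Module.End.mul_apply, ha, hb, mul_assoc]
    | add a b ha hb => intro p; rw [map_add, map_add, LinearMap.add_apply, map_add, ha, hb, add_mul]
  obtain ⟨u, rfl⟩ := RingQuot.mkAlgHom_surjective k (Rel h) w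
  have h1 : ofCoeffs h 1 = 1 := by
    rw [← monomial_zero_one, ofCoeffs_monomial]; simp
  have := key u 1
  rw [h1, mul_one] at this
  exact this

/-- Every element of `A_h` is `∑ gᵢ(x) tⁱ` for a unique polynomial `∑ gᵢ(x) Tⁱ` over `k[x]`. -/
def coeffsEquiv : A h ≃ₗ[k] k[X][X] where
  __ := toCoeffs h
  invFun := ofCoeffs h
  left_inv := ofCoeffs_toCoeffs h
  right_inv := toCoeffs_ofCoeffs h

/-- The degree in `t` of `w = ∑ gᵢ(x) tⁱ`, with value `⊥` (that is, `-∞`) at `w = 0`. -/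
def degT (w : A h) : WithBot ℕ := (coeffsEquiv h w).degree

/-! ### The derivations `Δ_s` -/

open DualNumber in
/-- The homomorphism `A_h → A_h[ε]` with `x ↦ x` and `t ↦ t + s(x) ε`. -/
def deltaHom (s : k[X]) : A h →ₐ[k] DualNumber (A h) :=
  lift (TrivSqZeroExt.inl (x h)) (TrivSqZeroExt.inl (t h) + TrivSqZeroExt.inr (ofPoly h s)) (by
    have e : aeval (TrivSqZeroExt.inl (x h) : DualNumber (A h)) h
        = TrivSqZeroExt.inl (ofPoly h h) := by
      rw [ofPoly]
      exact aeval_algHom_apply (TrivSqZeroExt.inlAlgHom k (A h) (A h)) (x h) h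
    rw [e]
    have c : ofPoly h s * x h = x h * ofPoly h s := by
      rw [← ofPoly_X, ← map_mul, ← map_mul, mul_comm]
    ext
    · simp [t_mul_x]
    · simp [c])

theorem deltaHom_fst (s : k[X]) (f : A h) : (deltaHom h s f).fst = f := by
  have : (TrivSqZeroExt.fstHom k (A h) (A h)).comp (deltaHom h s) = AlgHom.id k (A h) := by
    apply hom_ext <;> simp [deltaHom, lift_x, lift_t]
  exact DFunLike.congr_fun this f

/-- The derivation `Δ_s` of `A_h` with `Δ_s(x) = 0` and `Δ_s(t) = s(x)`. -/
def delta (s : k[X]) : Der k (A h) :=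
  ⟨TrivSqZeroExt.sndHom (A h) (A h) |>.restrictScalars k |>.comp (deltaHom h s).toLinearMap,
    fun f g => by
      simp only [LinearMap.comp_apply, AlgHom.toLinearMap_apply, LinearMap.restrictScalars_apply,
        TrivSqZeroExt.sndHom_apply, map_mul, TrivSqZeroExt.snd_mul, deltaHom_fst, smul_eq_mul,
        MulOpposite.smul_eq_mul_unop, MulOpposite.unop_op]
      exact add_comm _ _⟩

theorem delta_x (s : k[X]) : (delta h s).1 (x h) = 0 := by
  simp [delta, deltaHom, lift_x]

theorem delta_t (s : k[X]) : (delta h s).1 (t h) = ofPoly h s := by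
  simp [delta, deltaHom, lift_t]

/-! ### The automorphisms `σ_r` and `τ_a` -/

theorem sigma_rel (r : k[X]) :
    (t h + ofPoly h r) * x h = x h * (t h + ofPoly h r) + aeval (x h) h := by
  have c : ofPoly h r * x h = x h * ofPoly h r := by
    rw [← ofPoly_X, ← map_mul, ← map_mul, mul_comm]
  rw [add_mul, mul_add, t_mul_x, c, ofPoly]
  abel

/-- The endomorphism `x ↦ x`, `t ↦ t + r(x)`. -/
def sigmaHom (r : k[X]) : A h →ₐ[k] A h := lift (x h) (t h + ofPoly h r) (sigma_rel h r)

theorem sigmaHom_ofPoly (r f : k[X]) : sigmaHom h r (ofPoly h f) = ofPoly h f := by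
  rw [sigmaHom, lift_ofPoly, ofPoly]

theorem sigmaHom_comp (r q : k[X]) (hrq : r + q = 0) :
    (sigmaHom h r).comp (sigmaHom h q) = AlgHom.id k (A h) := by
  apply hom_ext
  · simp [sigmaHom, lift_x]
  · have e : sigmaHom h q (t h) = t h + ofPoly h q := lift_t _ _ _
    have e' : sigmaHom h r (t h) = t h + ofPoly h r := lift_t _ _ _
    rw [AlgHom.comp_apply, e, map_add, e', sigmaHom_ofPoly, add_assoc, ← map_add, hrq, map_zero,
      add_zero, AlgHom.id_apply]

/-- The automorphism `σ_r` of `A_h` with `σ_r(x) = x` and `σ_r(t) = t + r(x)`. -/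
def sigma (r : k[X]) : A h ≃ₐ[k] A h :=
  AlgEquiv.ofAlgHom (sigmaHom h r) (sigmaHom h (-r))
    (sigmaHom_comp h r (-r) (add_neg_cancel r)) (sigmaHom_comp h (-r) r (neg_add_cancel r))

theorem sigma_x (r : k[X]) : sigma h r (x h) = x h := lift_x _ _ _

theorem sigma_t (r : k[X]) : sigma h r (t h) = t h + ofPoly h r := lift_t _ _ _

/-- The condition `h(a x) = a ^ N h(x)`, where `N = deg h`. -/
def Scales (a : kˣ) : Prop := h.comp (C (a : k) * X) = C ((a : k) ^ h.natDegree) * h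

variable {h}

theorem Scales.inv {a : kˣ} (ha : Scales h a) : Scales h a⁻¹ := by
  have e : (C (a : k) * X : k[X]).comp (C ((a⁻¹ : kˣ) : k) * X) = X := by
    rw [mul_comp, C_comp, X_comp, ← mul_assoc, ← C_mul, Units.mul_inv, C_1, one_mul]
  have h1 : h = C ((a : k) ^ h.natDegree) * h.comp (C ((a⁻¹ : kˣ) : k) * X) := by
    have h2 := congrArg (fun p : k[X] => p.comp (C ((a⁻¹ : kˣ) : k) * X)) ha
    simp only [comp_assoc, e, comp_X, mul_comp, C_comp] at h2
    exact h2
  unfold Scales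
  conv_rhs => rw [h1]
  have hu : ((a⁻¹ : kˣ) : k) ^ h.natDegree * (a : k) ^ h.natDegree = 1 := by
    rw [← mul_pow, Units.inv_mul, one_pow]
  rw [natDegree_C_mul (pow_ne_zero _ a.ne_zero), natDegree_comp, natDegree_C_mul_X _ (Units.ne_zero _),
    mul_one, ← mul_assoc, ← C_mul, hu, C_1, one_mul]

theorem tau_rel {a : kˣ} (ha : Scales h a) :
    (((a ^ ((h.natDegree : ℤ) - 1) : kˣ) : k) • t h) * ((a : k) • x h)
      = ((a : k) • x h) * (((a ^ ((h.natDegree : ℤ) - 1) : kˣ) : k) • t h)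
        + aeval ((a : k) • x h) h := by
  have e : aeval ((a : k) • x h) h = ((a : k) ^ h.natDegree) • ofPoly h h := by
    have h1 := congrArg (aeval (x h)) ha
    rw [aeval_comp] at h1
    simpa [Algebra.smul_def, ofPoly] using h1
  have e2 : ((a ^ ((h.natDegree : ℤ) - 1) : kˣ) : k) * (a : k) = (a : k) ^ h.natDegree := by
    rw [← Units.val_mul, zpow_sub_one, inv_mul_cancel_right, zpow_natCast, Units.val_pow_eq_pow_val]
  rw [e, smul_mul_smul_comm, smul_mul_smul_comm, mul_comm (a : k), e2, t_mul_x, smul_add]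

/-- The endomorphism `x ↦ a x`, `t ↦ a ^ (N - 1) t`, where `N = deg h`. -/
def tauHom {a : kˣ} (ha : Scales h a) : A h →ₐ[k] A h := lift _ _ (tau_rel ha)

theorem tauHom_x {a : kˣ} (ha : Scales h a) : tauHom ha (x h) = (a : k) • x h := lift_x _ _ _

theorem tauHom_t {a : kˣ} (ha : Scales h a) :
    tauHom ha (t h) = ((a ^ ((h.natDegree : ℤ) - 1) : kˣ) : k) • t h := lift_t _ _ _

theorem tauHom_comp {a b : kˣ} (ha : Scales h a) (hb : Scales h b) (hab : a * b = 1) :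
    (tauHom ha).comp (tauHom hb) = AlgHom.id k (A h) := by
  apply hom_ext
  · rw [AlgHom.comp_apply, tauHom_x, map_smul, tauHom_x, smul_smul, ← Units.val_mul, mul_comm b, hab,
      Units.val_one, one_smul, AlgHom.id_apply]
  · rw [AlgHom.comp_apply, tauHom_t, map_smul, tauHom_t, smul_smul, ← Units.val_mul, ← mul_zpow,
      mul_comm b, hab, one_zpow, Units.val_one, one_smul, AlgHom.id_apply]

/-- The automorphism `τ_a` of `A_h` with `τ_a(x) = a x` and `τ_a(t) = a ^ (N - 1) t`, where
`N = deg h` and `h(a x) = a ^ N h(x)`. -/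
def tau {a : kˣ} (ha : Scales h a) : A h ≃ₐ[k] A h :=
  AlgEquiv.ofAlgHom (tauHom ha) (tauHom ha.inv)
    (tauHom_comp ha ha.inv (mul_inv_cancel a)) (tauHom_comp ha.inv ha (inv_mul_cancel a))

theorem tau_x {a : kˣ} (ha : Scales h a) : tau ha (x h) = (a : k) • x h := lift_x _ _ _

theorem tau_t {a : kˣ} (ha : Scales h a) :
    tau ha (t h) = ((a ^ ((h.natDegree : ℤ) - 1) : kˣ) : k) • t h := lift_t _ _ _

variable (h)

/-- The set `k[x] ⋊ G_n` of all automorphisms `σ_r ∘ τ_a` of `A_h` with `r ∈ k[x]` and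
`a ^ n = 1`. -/
def polyRoots (n : ℕ) : Set (A h ≃ₐ[k] A h) :=
  {ρ | ∃ (r : k[X]) (a : kˣ) (ha : Scales h a), a ^ n = 1 ∧ ρ = sigma h r * tau ha}

end Basic

end DiffOre

end

/-!
The degree in `t` is additive on products, the ideal `h A_h` contains all commutators because
`A_h / h A_h` is the commutative ring `(k[x] / h)[T]`, and `[w, x] = h w'` where `w'` has degree in
`t` exactly one less than `w` (`exists_commutator_x_eq`). In particular the centralizer of `x` is
`k[x]`.

*Automorphisms.* Since `h = [t, x]`, an automorphism `ρ` maps `h` to a multiple of `h`, as does its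
inverse; so `ρ(h)` has degree `0` in `t`, and hence so has `ρ(x)`. It follows that `ρ(x) = a x + b`,
and comparing coefficients in `ρ(h) = c h` gives `b = 0` and `h(a x) = a ^ N h(x)`
(`exists_aut_x_eq_smul`). Then `ρ(t) = a ^ (N - 1) t + r(x)`.

*Reduction to `ρ(w) - w ∈ k`.* If `ρ` commutes with `ad_w + Δ_s`, evaluation at `x` shows that
`g = ρ(w) - w` commutes with `x`, thus `g ∈ k[x]`; evaluation at `t` shows that `h g'` is a
combination of `s(x)` and `s(a x)`, of degree less than `deg h`, thus `g' = 0`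
(`exists_aut_sub_eq_algebraMap`).

*The constant vanishes.* Suppose `ρ(w) = w + c`. If `w ∈ k[x]`, evaluate at `x = 0`. Otherwise `a` is
a root of unity: by hypothesis, or, for `N ≥ 2`, by comparing leading terms in `t`. Replacing `ρ` by a
power, which replaces `c` by a positive multiple, one may assume `ρ(x) = x`. If `w` has degree at
least two in `t`, the element `w'` is fixed by `ρ`, which forces `ρ = 1`; if `w = f t + g` then
`c = f r`, and `c ≠ 0` would make `f` constant (`eq_zero_of_aut_eq_add`).
-/

namespace DiffOre

section Field

variable {k : Type*} [Field k] {h : k[X]}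

/-! ### Normal forms and the degree in `t` -/

theorem toCoeffs_ofPoly_mul (f : k[X]) (w : A h) :
    toCoeffs h (ofPoly h f * w) = C f * toCoeffs h w := by
  obtain ⟨p, rfl⟩ : ∃ p, w = ofCoeffs h p := ⟨_, (ofCoeffs_toCoeffs h w).symm⟩
  rw [toCoeffs_ofCoeffs]
  conv_rhs => rw [← toCoeffs_ofCoeffs h (C f * p)]
  congr 1
  induction p using Polynomial.induction_on' with
  | add p q hp hq => rw [map_add, mul_add, mul_add, map_add, hp, hq]
  | monomial n g =>
    rw [C_mul_monomial, ofCoeffs_monomial, ofCoeffs_monomial, map_mul, mul_assoc]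

theorem ofPoly_mul_ofCoeffs (f : k[X]) (p : k[X][X]) :
    ofPoly h f * ofCoeffs h p = ofCoeffs h (C f * p) := by
  rw [← ofCoeffs_toCoeffs h (ofPoly h f * _), toCoeffs_ofPoly_mul, toCoeffs_ofCoeffs]

theorem ofCoeffs_C (f : k[X]) : ofCoeffs h (C f) = ofPoly h f := by
  rw [← monomial_zero_left, ofCoeffs_monomial, pow_zero, mul_one]

theorem ofCoeffs_X : ofCoeffs h X = t h := by
  rw [← monomial_one_one_eq_X, ofCoeffs_monomial, pow_one, map_one, one_mul]

theorem toCoeffs_ofPoly (f : k[X]) : toCoeffs h (ofPoly h f) = C f := by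
  rw [← ofCoeffs_C, toCoeffs_ofCoeffs]

theorem toCoeffs_injective : Function.Injective (toCoeffs h) := (coeffsEquiv h).injective

theorem ofPoly_injective : Function.Injective (ofPoly h) := fun f g e => by
  have := congrArg (toCoeffs h) e
  rwa [toCoeffs_ofPoly, toCoeffs_ofPoly, C_inj] at this

theorem ofPoly_mul_left_cancel {f : k[X]} (hf : f ≠ 0) {u v : A h}
    (e : ofPoly h f * u = ofPoly h f * v) : u = v := by
  have := congrArg (toCoeffs h) e
  rw [toCoeffs_ofPoly_mul, toCoeffs_ofPoly_mul] at this
  exact toCoeffs_injective (mul_left_cancel₀ (C_ne_zero.2 hf) this)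

theorem degT_def (w : A h) : degT h w = (toCoeffs h w).degree := rfl

theorem degT_ofPoly_mul {f : k[X]} (hf : f ≠ 0) (w : A h) :
    degT h (ofPoly h f * w) = degT h w := by
  rw [degT_def, toCoeffs_ofPoly_mul, degree_C_mul hf, degT_def]

theorem eq_ofPoly_of_degT_le {w : A h} (hw : degT h w ≤ 0) : ∃ f, w = ofPoly h f :=
  ⟨(toCoeffs h w).coeff 0, by
    rw [← ofCoeffs_C, ← eq_C_of_degree_le_zero (p := toCoeffs h w) hw, ofCoeffs_toCoeffs]⟩

theorem coeff_coeffDer (p : k[X][X]) (i : ℕ) :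
    (coeffDer h p).coeff i = h * derivative (p.coeff i) := by
  induction p using Polynomial.induction_on' with
  | add p q hp hq => rw [map_add, coeff_add, coeff_add, hp, hq, map_add, mul_add]
  | monomial n g =>
    rw [coeffDer_monomial, coeff_monomial, coeff_monomial]
    split_ifs <;> simp

theorem degree_coeffDer_lt {p : k[X][X]} {n : ℕ} (hp : p.degree < n) :
    (coeffDer h p).degree < n := by
  rw [degree_lt_iff_coeff_zero] at hp ⊢
  intro m hm
  rw [coeff_coeffDer, hp m hm, map_zero, mul_zero]

theorem degree_X_pow_mul_lt {p : k[X][X]} {n : ℕ} (hp : p.degree < n) (i : ℕ) :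
    (X ^ i * p).degree < ((i + n : ℕ) : WithBot ℕ) := by
  rw [degree_lt_iff_coeff_zero] at hp ⊢
  intro m hm
  rw [coeff_X_pow_mul']
  split_ifs
  · exact hp _ (by omega)
  · rfl

theorem degree_X_mul_lt {p : k[X][X]} {n : ℕ} (hp : p.degree < n) :
    (X * p).degree < ((n + 1 : ℕ) : WithBot ℕ) := by
  simpa [add_comm] using degree_X_pow_mul_lt hp 1

theorem degree_C_mul_lt {p : k[X][X]} {n : ℕ} (hp : p.degree < n) (f : k[X]) :
    (C f * p).degree < n := by
  rw [degree_lt_iff_coeff_zero] at hp ⊢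
  intro m hm
  rw [coeff_C_mul, hp m hm, mul_zero]

theorem degree_add_lt {p q : k[X][X]} {n : ℕ} (hp : p.degree < n) (hq : q.degree < n) :
    (p + q).degree < n :=
  (degree_add_le _ _).trans_lt (max_lt hp hq)

theorem degree_lt_of_lt_of_le {p : k[X][X]} {m n : ℕ} (hp : p.degree < m) (h : m ≤ n) :
    p.degree < n :=
  hp.trans_le (by exact_mod_cast h)

theorem degree_zero_lt_natCast (n : ℕ) : (0 : k[X][X]).degree < n := by
  rw [degree_zero]; exact WithBot.bot_lt_coe n

theorem t_mul_ofCoeffs (p : k[X][X]) :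
    t h * ofCoeffs h p = ofCoeffs h (X * p + coeffDer h p) :=
  (ofCoeffs_actT h p).symm

theorem exists_t_pow_mul_ofCoeffs {q : k[X][X]} {m : ℕ}
    (hq : q.degree < ((m + 1 : ℕ) : WithBot ℕ)) (i : ℕ) :
    ∃ r : k[X][X], r.degree < ((i + m : ℕ) : WithBot ℕ) ∧
      t h ^ i * ofCoeffs h q = ofCoeffs h (X ^ i * q + r) := by
  induction i with
  | zero => exact ⟨0, degree_zero_lt_natCast _, by simp⟩
  | succ i ih =>
    obtain ⟨r, hr, e⟩ := ih
    refine ⟨X * r + coeffDer h (X ^ i * q + r), ?_, ?_⟩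
    · rw [add_right_comm]
      refine degree_add_lt (degree_X_mul_lt hr) (degree_coeffDer_lt (degree_add_lt ?_ ?_))
      · exact degree_X_pow_mul_lt hq i
      · exact degree_lt_of_lt_of_le hr (by omega)
    · rw [pow_succ', mul_assoc, e, t_mul_ofCoeffs]
      exact congrArg (ofCoeffs h) (by ring)

/-- The product of `A_h` agrees with that of `k[x][T]` up to terms of lower degree in `T`. -/
theorem exists_ofCoeffs_mul_ofCoeffs {q : k[X][X]} {m : ℕ}
    (hq : q.degree < ((m + 1 : ℕ) : WithBot ℕ)) (n : ℕ) (p : k[X][X]) (hp : p.natDegree ≤ n) :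
    ∃ r : k[X][X], r.degree < ((n + m : ℕ) : WithBot ℕ) ∧
      ofCoeffs h p * ofCoeffs h q = ofCoeffs h (p * q + r) := by
  refine induction_with_natDegree_le (fun p =>
    ∃ r : k[X][X], r.degree < ((n + m : ℕ) : WithBot ℕ) ∧
      ofCoeffs h p * ofCoeffs h q = ofCoeffs h (p * q + r)) n ?_ ?_ ?_ p hp
  · exact ⟨0, degree_zero_lt_natCast _, by simp⟩
  · intro i f _ hi
    obtain ⟨r, hr, e⟩ := exists_t_pow_mul_ofCoeffs (h := h) hq i
    refine ⟨C f * r, degree_C_mul_lt (degree_lt_of_lt_of_le hr (by omega)) f, ?_⟩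
    rw [C_mul_X_pow_eq_monomial, ofCoeffs_monomial, mul_assoc, e, ofPoly_mul_ofCoeffs,
      ← C_mul_X_pow_eq_monomial, mul_add, mul_assoc]
  · rintro f g _ _ ⟨r, hr, e⟩ ⟨r', hr', e'⟩
    refine ⟨r + r', degree_add_lt hr hr', ?_⟩
    rw [map_add, add_mul, e, e', ← map_add]
    exact congrArg (ofCoeffs h) (by ring)

theorem degT_mul (u v : A h) : degT h (u * v) = degT h u + degT h v := by
  obtain ⟨p, rfl⟩ : ∃ p, u = ofCoeffs h p := ⟨_, (ofCoeffs_toCoeffs h u).symm⟩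
  obtain ⟨q, rfl⟩ : ∃ p, v = ofCoeffs h p := ⟨_, (ofCoeffs_toCoeffs h v).symm⟩
  by_cases hp : p = 0
  · simp [hp, degT_def]
  by_cases hq : q = 0
  · simp [hq, degT_def]
  obtain ⟨r, hr, e⟩ := exists_ofCoeffs_mul_ofCoeffs (h := h) (q := q) (m := q.natDegree)
    (by rw [degree_eq_natDegree hq]; exact_mod_cast Nat.lt_succ_self _) p.natDegree p le_rfl
  rw [e]
  simp only [degT_def, toCoeffs_ofCoeffs]
  rw [degree_add_eq_left_of_degree_lt, degree_mul]
  rwa [degree_mul, degree_eq_natDegree hp, degree_eq_natDegree hq, ← Nat.cast_add]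

theorem degT_one : degT h (1 : A h) = 0 := by
  rw [← map_one (ofPoly h), degT_def, toCoeffs_ofPoly]
  simp

/-! ### The commutator with `x` -/

theorem ofPoly_mul_comm (f g : k[X]) : ofPoly h f * ofPoly h g = ofPoly h g * ofPoly h f := by
  rw [← map_mul, mul_comm, map_mul]

theorem exists_t_pow_mul_x (n : ℕ) :
    ∃ r : k[X][X], r.degree < n ∧
      t h ^ (n + 1) * x h - x h * t h ^ (n + 1)
        = ofPoly h h * ofCoeffs h (C (n + 1 : k[X]) * X ^ n + r) := by
  induction n with
  | zero => exact ⟨0, degree_zero_lt_natCast _, by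
      simp [t_mul_x, show ofCoeffs h 1 = 1 by rw [← C_1, ofCoeffs_C, map_one]]⟩
  | succ n ih =>
    obtain ⟨r, hr, e⟩ := ih
    set p : k[X][X] := C (n + 1 : k[X]) * X ^ n + r with hp
    have hpd : p.degree < ((n + 1 : ℕ) : WithBot ℕ) :=
      degree_add_lt ((degree_C_mul_X_pow_le _ _).trans_lt (by exact_mod_cast Nat.lt_succ_self n))
        (degree_lt_of_lt_of_le hr (by omega))
    refine ⟨X * r + coeffDer h p + C (derivative h) * p,
      degree_add_lt (degree_add_lt (degree_X_mul_lt hr) (degree_coeffDer_lt hpd))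
        (degree_C_mul_lt hpd _), ?_⟩
    have e1 : t h ^ (n + 1 + 1) * x h - x h * t h ^ (n + 1 + 1)
        = t h * (t h ^ (n + 1) * x h - x h * t h ^ (n + 1)) + ofPoly h h * t h ^ (n + 1) := by
      rw [pow_succ' (t h) (n + 1), mul_sub, ← mul_assoc (t h) (x h), t_mul_x]
      noncomm_ring
    have e2 : t h ^ (n + 1) = ofCoeffs h (X ^ (n + 1)) := by
      rw [← monomial_one_right_eq_X_pow, ofCoeffs_monomial, map_one, one_mul]
    rw [e1, e, ← mul_assoc, t_mul_ofPoly, add_mul, mul_assoc, t_mul_ofCoeffs, e2]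
    simp only [ofPoly_mul_ofCoeffs, ← map_add]
    refine congrArg (ofCoeffs h) ?_
    rw [hp]
    push_cast
    simp only [C_add, C_mul, C_1]
    ring

/-- Up to lower terms, commuting with `x` acts on normal forms as `h` times the derivative in `T`. -/
theorem exists_commutator_x (n : ℕ) (p : k[X][X]) (hp : p.natDegree ≤ n) :
    ∃ r : k[X][X], r.degree < ((n - 1 : ℕ) : WithBot ℕ) ∧
      ofCoeffs h p * x h - x h * ofCoeffs h p
        = ofPoly h h * ofCoeffs h (derivative p + r) := by
  refine induction_with_natDegree_le (fun p =>
    ∃ r : k[X][X], r.degree < ((n - 1 : ℕ) : WithBot ℕ) ∧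
      ofCoeffs h p * x h - x h * ofCoeffs h p
        = ofPoly h h * ofCoeffs h (derivative p + r)) n ?_ ?_ ?_ p hp
  · exact ⟨0, degree_zero_lt_natCast _, by simp⟩
  · intro i f _ hi
    rw [C_mul_X_pow_eq_monomial, ofCoeffs_monomial]
    rcases i with _ | i
    · refine ⟨0, degree_zero_lt_natCast _, ?_⟩
      rw [← ofPoly_X, pow_zero, mul_one, ofPoly_mul_comm, sub_self]
      simp
    · obtain ⟨r, hr, e⟩ := exists_t_pow_mul_x (h := h) i
      refine ⟨C f * r, degree_C_mul_lt (degree_lt_of_lt_of_le hr (by omega)) f, ?_⟩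
      have e1 : ofPoly h f * t h ^ (i + 1) * x h - x h * (ofPoly h f * t h ^ (i + 1))
          = ofPoly h f * (t h ^ (i + 1) * x h - x h * t h ^ (i + 1)) := by
        rw [mul_sub, ← mul_assoc (x h), ← ofPoly_X, ofPoly_mul_comm X f]
        noncomm_ring
      rw [e1, e, ← mul_assoc, ofPoly_mul_comm, mul_assoc, ofPoly_mul_ofCoeffs]
      congr 2
      rw [derivative_monomial, ← C_mul_X_pow_eq_monomial, C_mul, mul_add, mul_assoc]
      simp
  · rintro f g _ _ ⟨r, hr, e⟩ ⟨r', hr', e'⟩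
    refine ⟨r + r', degree_add_lt hr hr', ?_⟩
    rw [map_add (ofCoeffs h), add_mul, mul_add, add_sub_add_comm, e, e', ← mul_add, ← map_add,
      map_add derivative]
    exact congrArg (fun q => ofPoly h h * ofCoeffs h q) (by ring)

/-- Commuting with `x` produces a factor `h` and lowers the degree in `t` by exactly one. -/
theorem exists_commutator_x_eq [CharZero k] {w : A h} {n : ℕ}
    (hw : degT h w = ((n + 1 : ℕ) : WithBot ℕ)) :
    ∃ w' : A h, degT h w' = n ∧ w * x h - x h * w = ofPoly h h * w' := by
  have hn := natDegree_eq_of_degree_eq_some ((degT_def w).symm.trans hw)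
  obtain ⟨r, hr, e⟩ := exists_commutator_x (h := h) (n + 1) (toCoeffs h w) hn.le
  rw [ofCoeffs_toCoeffs] at e
  refine ⟨_, ?_, e⟩
  have hd : (derivative (toCoeffs h w)).degree = n := by
    rw [degree_derivative (by omega), hn, Nat.add_sub_cancel]
  rw [degT_def, toCoeffs_ofCoeffs, degree_add_eq_left_of_degree_lt, hd]
  rw [hd]
  exact hr

theorem exists_degT_eq_succ {w : A h} (hw : ¬ degT h w ≤ 0) :
    ∃ n : ℕ, degT h w = ((n + 1 : ℕ) : WithBot ℕ) := by
  rw [degT_def, ← natDegree_eq_zero_iff_degree_le_zero] at hw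
  obtain ⟨n, hn⟩ := Nat.exists_eq_succ_of_ne_zero hw
  exact ⟨n, by rw [degT_def, degree_eq_iff_natDegree_eq_of_pos (by omega), hn]⟩

/-- The centralizer of `x` is `k[x]`. -/
theorem exists_eq_ofPoly_of_commute_x [CharZero k] (h0 : h ≠ 0) {w : A h}
    (hw : w * x h = x h * w) : ∃ f, w = ofPoly h f := by
  by_contra hne
  obtain ⟨n, hn⟩ := exists_degT_eq_succ (w := w) fun hd => hne (eq_ofPoly_of_degT_le hd)
  obtain ⟨w', hw', e⟩ := exists_commutator_x_eq hn
  rw [hw, sub_self, ← mul_zero (ofPoly h h)] at e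
  rw [← ofPoly_mul_left_cancel h0 e, degT_def, map_zero, degree_zero] at hw'
  exact WithBot.bot_ne_coe hw'

/-! ### The ideal generated by `h` -/

theorem aeval_C_root : aeval (C (AdjoinRoot.root h) : (AdjoinRoot h)[X]) h = 0 := by
  rw [← algebraMap_eq, aeval_algebraMap_apply, AdjoinRoot.aeval_eq, AdjoinRoot.mk_self, map_zero]

/-- Reduction modulo `h` of the coefficients of the normal form, a homomorphism from `A_h` to the
commutative ring `(k[x] / h)[T]`. -/
noncomputable def reduce (h : k[X]) : A h →ₐ[k] (AdjoinRoot h)[X] :=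
  lift (C (AdjoinRoot.root h)) X (by rw [aeval_C_root, add_zero, mul_comm])

theorem reduce_ofCoeffs (p : k[X][X]) :
    reduce h (ofCoeffs h p) = p.map (AdjoinRoot.mk h) := by
  induction p using Polynomial.induction_on' with
  | add p q hp hq => rw [map_add, map_add, hp, hq, Polynomial.map_add]
  | monomial n g =>
    rw [ofCoeffs_monomial, map_mul, map_pow, reduce, lift_ofPoly, lift_t, map_monomial,
      ← algebraMap_eq, aeval_algebraMap_apply, AdjoinRoot.aeval_eq, algebraMap_eq,
      C_mul_X_pow_eq_monomial]

theorem exists_eq_ofPoly_mul_of_reduce_eq_zero {w : A h} (hw : reduce h w = 0) :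
    ∃ u, w = ofPoly h h * u := by
  rw [← ofCoeffs_toCoeffs h w, reduce_ofCoeffs] at hw
  have hd : C h ∣ toCoeffs h w := by
    rw [C_dvd_iff_dvd_coeff]
    intro i
    rw [← AdjoinRoot.mk_eq_zero, ← coeff_map, hw, coeff_zero]
  obtain ⟨q, hq⟩ := hd
  exact ⟨ofCoeffs h q, by rw [ofPoly_mul_ofCoeffs, ← hq, ofCoeffs_toCoeffs]⟩

/-- The two-sided ideal generated by `h` contains all commutators. -/
theorem exists_commutator_eq_ofPoly_mul (u v : A h) : ∃ z, u * v - v * u = ofPoly h h * z :=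
  exists_eq_ofPoly_mul_of_reduce_eq_zero (by
    rw [map_sub, map_mul, map_mul, mul_comm, sub_self])

/-! ### Automorphisms -/

theorem ofPoly_eq_commutator : ofPoly h h = t h * x h - x h * t h := by
  rw [t_mul_x, add_sub_cancel_left]

theorem exists_aut_ofPoly_eq (ρ : A h ≃ₐ[k] A h) : ∃ u, ρ (ofPoly h h) = ofPoly h h * u := by
  rw [ofPoly_eq_commutator, map_sub, map_mul, map_mul, ← ofPoly_eq_commutator]
  exact exists_commutator_eq_ofPoly_mul _ _

/-- Both `ρ` and its inverse map `h` to a multiple of `h`, so `ρ(h) = h u` with `u` invertible. -/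
theorem degT_aut_ofPoly (h0 : h ≠ 0) (ρ : A h ≃ₐ[k] A h) : degT h (ρ (ofPoly h h)) = 0 := by
  obtain ⟨u, hu⟩ := exists_aut_ofPoly_eq ρ
  obtain ⟨v, hv⟩ := exists_aut_ofPoly_eq ρ.symm
  have e : ofPoly h h * (u * ρ v) = ofPoly h h * 1 := by
    rw [← mul_assoc, ← hu, ← map_mul, ← hv, AlgEquiv.apply_symm_apply, mul_one]
  have e1 := congrArg (degT h) (ofPoly_mul_left_cancel h0 e)
  rw [degT_mul, degT_one, Nat.WithBot.add_eq_zero_iff] at e1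
  rw [hu, degT_ofPoly_mul h0, e1.1]

theorem aut_ofPoly (ρ : A h ≃ₐ[k] A h) {p : k[X]} (hp : ρ (x h) = ofPoly h p) (f : k[X]) :
    ρ (ofPoly h f) = ofPoly h (f.comp p) := by
  rw [ofPoly, ← aeval_algHom_apply, hp, ofPoly, aeval_comp]

theorem ofPoly_C (c : k) : ofPoly h (C c) = algebraMap k (A h) c := by
  rw [ofPoly, aeval_C]

/-- A linear factor `X - c` of `h` gives a factor `ρ(x) - c` of `ρ(h)`, and `ρ(h)` has degree `0` in
`t`. -/
theorem exists_aut_x_eq_ofPoly [IsAlgClosed k] (hdeg : 1 ≤ h.natDegree) (ρ : A h ≃ₐ[k] A h) :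
    ∃ p, ρ (x h) = ofPoly h p := by
  have h0 : h ≠ 0 := by rintro rfl; simp at hdeg
  obtain ⟨c, hc⟩ := IsAlgClosed.exists_root h (by
    rw [degree_eq_natDegree h0]; exact_mod_cast (by omega : h.natDegree ≠ 0))
  obtain ⟨q, hq⟩ := dvd_iff_isRoot.2 hc
  have e := degT_aut_ofPoly h0 ρ
  have e2 : ρ (ofPoly h h) = ρ (ofPoly h (X - C c)) * ρ (ofPoly h q) := by
    rw [← map_mul, ← map_mul, ← hq]
  rw [e2, degT_mul, Nat.WithBot.add_eq_zero_iff] at e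
  obtain ⟨f, hf⟩ := eq_ofPoly_of_degT_le e.1.le
  refine ⟨f + C c, ?_⟩
  rw [map_add, ← hf, map_sub, ofPoly_X, map_sub, ofPoly_C, AlgEquiv.commutes, sub_add_cancel]

theorem exists_aut_x_eq_linear [IsAlgClosed k] (hdeg : 1 ≤ h.natDegree) (ρ : A h ≃ₐ[k] A h) :
    ∃ a b : k, a ≠ 0 ∧ ρ (x h) = ofPoly h (C a * X + C b) := by
  obtain ⟨p, hp⟩ := exists_aut_x_eq_ofPoly hdeg ρ
  obtain ⟨q, hq⟩ := exists_aut_x_eq_ofPoly hdeg ρ.symm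
  have e : q.comp p = X := by
    apply ofPoly_injective (h := h)
    rw [← aut_ofPoly ρ hp, ← hq, AlgEquiv.apply_symm_apply, ofPoly_X]
  have e1 := congrArg natDegree e
  rw [natDegree_comp, natDegree_X, mul_eq_one] at e1
  obtain ⟨a, ha, b, hab⟩ := natDegree_eq_one.1 e1.2
  exact ⟨a, b, ha, by rw [hp, hab]⟩

/-- The second coefficient of `h(a X + b)`, read off from the Taylor expansion of `h` at `b`. -/
theorem coeff_natDegree_sub_one_comp (hdeg : 1 ≤ h.natDegree) (a b : k) :
    (h.comp (C a * X + C b)).coeff (h.natDegree - 1)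
      = (h.coeff (h.natDegree - 1) + h.natDegree * h.leadingCoeff * b) * a ^ (h.natDegree - 1) := by
  have e : h.comp (C a * X + C b) = (taylor b h).comp (C a * X) := by
    rw [taylor_apply, comp_assoc]; simp
  have hd : (hasseDeriv (h.natDegree - 1) h).natDegree ≤ 1 :=
    (natDegree_hasseDeriv_le _ _).trans (by omega)
  rw [e, comp_C_mul_X_coeff, taylor_coeff, eval_eq_sum_range' (n := 2) (by omega),
    Finset.sum_range_succ, Finset.sum_range_one, hasseDeriv_coeff, hasseDeriv_coeff]
  have e1 : 1 + (h.natDegree - 1) = h.natDegree := by omega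
  have e2 : h.natDegree.choose (h.natDegree - 1) = h.natDegree := by
    rw [Nat.choose_symm hdeg, Nat.choose_one_right]
  rw [e1, e2]
  simp

/-- An automorphism scales `x`: it maps `k[x]` to itself and multiplies `h` by a scalar, and the
vanishing second coefficient of `h` excludes a translation. -/
theorem exists_aut_x_eq_smul [IsAlgClosed k] [CharZero k] (hdeg : 1 ≤ h.natDegree)
    (hmonic : h.Monic) (hcoeff : h.coeff (h.natDegree - 1) = 0) (ρ : A h ≃ₐ[k] A h) :
    ∃ a : kˣ, Scales h a ∧ ρ (x h) = (a : k) • x h := by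
  obtain ⟨a, b, ha, hab⟩ := exists_aut_x_eq_linear hdeg ρ
  have h0 := hmonic.ne_zero
  obtain ⟨u, hu⟩ := exists_aut_ofPoly_eq ρ
  have hu0 := degT_aut_ofPoly h0 ρ
  rw [hu, degT_ofPoly_mul h0] at hu0
  obtain ⟨v, rfl⟩ := eq_ofPoly_of_degT_le hu0.le
  rw [aut_ofPoly ρ hab, ← map_mul] at hu
  have hv := ofPoly_injective hu
  have hl : (C a * X + C b).natDegree = 1 := natDegree_linear ha
  have hv0 : v ≠ 0 := by
    rintro rfl
    rw [degT_def, map_zero, map_zero, degree_zero] at hu0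
    exact WithBot.bot_ne_zero hu0
  have hvd := congrArg natDegree hv
  rw [natDegree_comp, hl, mul_one, natDegree_mul h0 hv0] at hvd
  obtain ⟨c, rfl⟩ : ∃ c, v = C c := ⟨_, eq_C_of_natDegree_eq_zero (by omega)⟩
  have hb := coeff_natDegree_sub_one_comp hdeg a b
  rw [hv, coeff_mul_C, hcoeff, zero_mul, zero_add, hmonic.leadingCoeff, mul_one, eq_comm,
    mul_eq_zero, or_iff_left (pow_ne_zero _ ha), mul_eq_zero,
    or_iff_right (Nat.cast_ne_zero.2 (by omega))] at hb
  subst hb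
  have hc := congrArg leadingCoeff hv
  rw [leadingCoeff_comp (by omega), leadingCoeff_mul, hmonic.leadingCoeff, leadingCoeff_linear ha,
    leadingCoeff_C, one_mul, one_mul] at hc
  refine ⟨Units.mk0 a ha, ?_, ?_⟩
  · rw [Scales, Units.val_mk0, hc, mul_comm _ h, ← hv, C_0, add_zero]
  · rw [hab, Units.val_mk0, C_0, add_zero, map_mul, ofPoly_C, ofPoly_X, Algebra.smul_def]

theorem smul_x_eq_ofPoly (a : k) : a • x h = ofPoly h (C a * X) := by
  rw [map_mul, ofPoly_C, ofPoly_X, Algebra.smul_def]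

theorem aut_ofPoly_self {a : kˣ} (ha : Scales h a) {ρ : A h ≃ₐ[k] A h}
    (hρ : ρ (x h) = (a : k) • x h) :
    ρ (ofPoly h h) = ((a : k) ^ h.natDegree) • ofPoly h h := by
  rw [smul_x_eq_ofPoly] at hρ
  rw [aut_ofPoly ρ hρ, ha, map_mul, ofPoly_C, Algebra.smul_def]

/-- The elements `ρ(t)` and `a ^ (N - 1) t` have the same commutator with `x`. -/
theorem exists_aut_t_eq [CharZero k] (h0 : h ≠ 0) (hdeg : 1 ≤ h.natDegree) {a : kˣ}
    (ha : Scales h a) {ρ : A h ≃ₐ[k] A h} (hρ : ρ (x h) = (a : k) • x h) :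
    ∃ r, ρ (t h) = ((a : k) ^ (h.natDegree - 1)) • t h + ofPoly h r := by
  obtain ⟨N, hN⟩ := Nat.exists_eq_add_of_le' hdeg
  have e := aut_ofPoly_self ha hρ
  rw [ofPoly_eq_commutator, map_sub, map_mul, map_mul, hρ, hN, pow_succ', mul_smul] at e
  rw [mul_smul_comm, smul_mul_assoc, ← smul_sub] at e
  have e1 := smul_right_injective _ a.ne_zero e
  obtain ⟨r, hr⟩ := exists_eq_ofPoly_of_commute_x (w := ρ (t h) - ((a : k) ^ N) • t h) h0 (by
    rw [sub_mul, mul_sub, sub_eq_sub_iff_sub_eq_sub]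
    simpa only [smul_sub, smul_mul_assoc, mul_smul_comm] using e1)
  exact ⟨r, by rw [hN, Nat.add_sub_cancel, ← hr, add_sub_cancel]⟩

/-! ### Automorphisms translating `w` by a constant -/

theorem eq_of_degT_eq_one {w : A h} (hw : degT h w = ((0 + 1 : ℕ) : WithBot ℕ)) :
    ∃ f g, f ≠ 0 ∧ w = ofPoly h f * t h + ofPoly h g := by
  obtain ⟨f, hf, g, hfg⟩ := natDegree_eq_one.1
    (natDegree_eq_of_degree_eq_some ((degT_def w).symm.trans hw))
  refine ⟨f, g, hf, ?_⟩
  rw [← ofCoeffs_toCoeffs h w, ← hfg, map_add, ofCoeffs_C, ← ofPoly_mul_ofCoeffs, ofCoeffs_X]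

/-- The cofactor `w'` of `h` in `[w, x]` is an eigenvector of `ρ` when `w` is one up to a constant;
the constant disappears in the commutator, and the exponent grows by `deg h - 1`. -/
theorem commutator_aut {a : kˣ} (ha : Scales h a) (hdeg : 1 ≤ h.natDegree) {ρ : A h ≃ₐ[k] A h}
    (hρ : ρ (x h) = (a : k) • x h) {w w' : A h} (hw' : w * x h - x h * w = ofPoly h h * w')
    {m : ℕ} {c : k} (hw : ((a : k) ^ m) • ρ w = w + algebraMap k (A h) c) :
    ((a : k) ^ (m + (h.natDegree - 1))) • ρ w' = w' := by
  have h0 : h ≠ 0 := by rintro rfl; simp at hdeg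
  obtain ⟨N, hN⟩ := Nat.exists_eq_add_of_le' hdeg
  have e := congrArg (fun u => ((a : k) ^ m) • ρ u) hw'
  simp only [map_sub, map_mul] at e
  rw [smul_sub, ← smul_mul_assoc, ← mul_smul_comm, hw, hρ, aut_ofPoly_self ha hρ, smul_mul_assoc,
    mul_smul_comm, smul_mul_assoc, ← smul_sub, add_mul, mul_add, ← Algebra.commutes c (x h),
    add_sub_add_right_eq_sub, hw', smul_smul, hN, pow_succ', mul_left_comm, mul_smul] at e
  have e1 := smul_right_injective _ a.ne_zero e
  rw [← mul_smul_comm, ← pow_add] at e1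
  rw [hN, Nat.add_sub_cancel]
  exact (ofPoly_mul_left_cancel h0 e1).symm

theorem aut_ofPoly_of_x {ρ : A h ≃ₐ[k] A h} (hρ : ρ (x h) = x h) (f : k[X]) :
    ρ (ofPoly h f) = ofPoly h f := by
  rw [aut_ofPoly ρ (p := X) (by rw [hρ, ofPoly_X]), comp_X]

theorem scales_one : Scales h (1 : kˣ) := by simp [Scales]

theorem aut_eq_one {ρ : A h ≃ₐ[k] A h} (hx : ρ (x h) = x h) (ht : ρ (t h) = t h) : ρ = 1 := by
  have : ρ.toAlgHom = AlgHom.id k (A h) := hom_ext hx ht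
  exact AlgEquiv.ext fun u => DFunLike.congr_fun this u

/-- An automorphism fixing `x` and an element outside `k[x]` is trivial: commutators with `x` reduce
to the case of degree one in `t`. -/
theorem aut_t_eq_of_fixed [CharZero k] (hdeg : 1 ≤ h.natDegree) {ρ : A h ≃ₐ[k] A h}
    (hρ : ρ (x h) = x h) (n : ℕ) (w : A h) (hn : degT h w = ((n + 1 : ℕ) : WithBot ℕ))
    (hw : ρ w = w) : ρ (t h) = t h := by
  have h0 : h ≠ 0 := by rintro rfl; simp at hdeg
  induction n generalizing w with
  | zero =>
    obtain ⟨f, g, hf, rfl⟩ := eq_of_degT_eq_one hn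
    rw [map_add, map_mul, aut_ofPoly_of_x hρ, aut_ofPoly_of_x hρ, add_left_inj] at hw
    exact ofPoly_mul_left_cancel hf hw
  | succ n ih =>
    obtain ⟨w', hd, e⟩ := exists_commutator_x_eq hn
    refine ih w' hd ?_
    have := commutator_aut scales_one hdeg (ρ := ρ) (by simpa using hρ) e (m := 0) (c := 0)
      (by simpa using hw)
    simpa using this

/-- In degree one in `t`, where `w = f t + g` and `ρ(t) = t + r`, the constant is `f r`, so that
`c ≠ 0` makes `f` a nonzero constant, which is the excluded form. In higher degree `ρ` is trivial. -/
theorem eq_zero_of_aut_x_eq [CharZero k] (hdeg : 1 ≤ h.natDegree) {ρ : A h ≃ₐ[k] A h}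
    (hρ : ρ (x h) = x h) {w : A h} (hd : ¬ degT h w ≤ 0)
    (hw : ¬ ∃ (α : k) (g : k[X]), α ≠ 0 ∧ w = α • t h + ofPoly h g) {c : k}
    (hc : ρ w = w + algebraMap k (A h) c) : c = 0 := by
  have h0 : h ≠ 0 := by rintro rfl; simp at hdeg
  obtain ⟨_ | n, hn⟩ := exists_degT_eq_succ hd
  · obtain ⟨f, g, hf, rfl⟩ := eq_of_degT_eq_one hn
    obtain ⟨r, hr⟩ := exists_aut_t_eq h0 hdeg scales_one (ρ := ρ) (by simpa using hρ)
    rw [Units.val_one, one_pow, one_smul] at hr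
    rw [map_add, map_mul, aut_ofPoly_of_x hρ, aut_ofPoly_of_x hρ, hr, mul_add, add_right_comm,
      add_right_inj, ← map_mul, ← ofPoly_C] at hc
    have e := ofPoly_injective hc
    by_contra hc0
    obtain ⟨α, hα, rfl⟩ := isUnit_iff.1
      (isUnit_of_mul_isUnit_left (e ▸ isUnit_C.2 (Ne.isUnit hc0)))
    exact hw ⟨α, g, hα.ne_zero, by rw [ofPoly_C, Algebra.smul_def]⟩
  · obtain ⟨w', hd', e⟩ := exists_commutator_x_eq hn
    have e1 := commutator_aut scales_one hdeg (ρ := ρ) (by simpa using hρ) e (m := 0)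
      (by simpa using hc)
    have ht := aut_t_eq_of_fixed hdeg hρ n w' hd' (by simpa using e1)
    rw [aut_eq_one hρ ht, AlgEquiv.one_apply, left_eq_add, ← ofPoly_C, ← map_zero (ofPoly h)] at hc
    exact C_eq_zero.1 (ofPoly_injective hc)

/-- A nonzero eigenvector, with eigenvalue `a ^ (-m)`, of an automorphism scaling `x` by `a`: if its
leading coefficient in `t` has degree `j`, comparison of the leading terms `x ^ j t ^ n` makes
`a` a root of unity of order dividing `m + j + n (N - 1)`, where `N = deg h`. The induction on `n`
replaces `w` by the cofactor of `h` in `[w, x]`. -/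
theorem exists_pow_eq_one [CharZero k] {a : kˣ} (ha : Scales h a) (hdeg : 1 ≤ h.natDegree)
    {ρ : A h ≃ₐ[k] A h} (hρ : ρ (x h) = (a : k) • x h) (n m : ℕ) (w : A h)
    (hn : degT h w = n) (hw : ((a : k) ^ m) • ρ w = w) : ∃ e ≥ m, (a : k) ^ e = 1 := by
  induction n generalizing w m with
  | zero =>
    obtain ⟨f, rfl⟩ := eq_ofPoly_of_degT_le (h := h) hn.le
    have hf : f ≠ 0 := by
      rintro rfl
      rw [degT_def, map_zero, map_zero, degree_zero] at hn
      exact WithBot.bot_ne_coe hn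
    rw [smul_x_eq_ofPoly] at hρ
    rw [aut_ofPoly ρ hρ, Algebra.smul_def, ← ofPoly_C, ← map_mul] at hw
    have e := congrArg (fun p => coeff p f.natDegree) (ofPoly_injective hw)
    simp only [coeff_C_mul, comp_C_mul_X_coeff] at e
    refine ⟨m + f.natDegree, by omega, ?_⟩
    rw [mul_left_comm, ← pow_add] at e
    exact mul_eq_left₀ (by simpa using hf) |>.1 e
  | succ n ih =>
    obtain ⟨w', hd, e⟩ := exists_commutator_x_eq hn
    obtain ⟨i, hi, hai⟩ := ih _ w' hd (commutator_aut ha hdeg hρ e (c := 0) (by simpa using hw))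
    exact ⟨i, by omega, hai⟩

theorem aut_pow_x {ρ : A h ≃ₐ[k] A h} {a : k} (hρ : ρ (x h) = a • x h) (e : ℕ) :
    (ρ ^ e) (x h) = (a ^ e) • x h := by
  induction e with
  | zero => simp
  | succ e ih => rw [pow_succ, AlgEquiv.mul_apply, hρ, map_smul, ih, smul_smul, pow_succ']

theorem aut_pow_eq_add {ρ : A h ≃ₐ[k] A h} {w : A h} {c : k}
    (hc : ρ w = w + algebraMap k (A h) c) (e : ℕ) :
    (ρ ^ e) w = w + algebraMap k (A h) (e * c) := by
  induction e with
  | zero => simp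
  | succ e ih =>
    rw [pow_succ, AlgEquiv.mul_apply, hc, map_add, ih, AlgEquiv.commutes, add_assoc, ← map_add,
      Nat.cast_succ, add_mul, one_mul]

/-- The scalar `a` is a root of unity: for `deg h ≥ 2` comparison of the leading terms of `ρ(w)` and
`w` in `t` forces this. Hence a power of `ρ` fixes `x`, and that power adds a positive multiple of
`c` to `w`. -/
theorem eq_zero_of_aut_eq_add [CharZero k] (hdeg : 1 ≤ h.natDegree) {a : kˣ} (ha : Scales h a)
    {ρ : A h ≃ₐ[k] A h} (hρ : ρ (x h) = (a : k) • x h)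
    (hroot : 2 ≤ h.natDegree ∨ ∃ e ≥ 1, (a : k) ^ e = 1) {w : A h}
    (hw : ¬ ∃ (α : k) (g : k[X]), α ≠ 0 ∧ w = α • t h + ofPoly h g) {c : k}
    (hc : ρ w = w + algebraMap k (A h) c) : c = 0 := by
  by_cases hd : degT h w ≤ 0
  · obtain ⟨f, rfl⟩ := eq_ofPoly_of_degT_le hd
    rw [smul_x_eq_ofPoly] at hρ
    rw [aut_ofPoly ρ hρ, ← ofPoly_C, ← map_add] at hc
    have e := congrArg (eval 0) (ofPoly_injective hc)
    simpa [eval_comp] using e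
  obtain ⟨e, he, hae⟩ : ∃ e ≥ 1, (a : k) ^ e = 1 := by
    rcases hroot with hN | hroot
    · obtain ⟨n, hn⟩ := exists_degT_eq_succ hd
      obtain ⟨w', hd', e⟩ := exists_commutator_x_eq hn
      obtain ⟨i, hi, hai⟩ := exists_pow_eq_one ha hdeg hρ n _ w' hd'
        (commutator_aut ha hdeg hρ e (m := 0) (by simpa using hc))
      exact ⟨i, by omega, hai⟩
    · exact hroot
  have := eq_zero_of_aut_x_eq hdeg (ρ := ρ ^ e) (by rw [aut_pow_x hρ, hae, one_smul]) hd hw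
    (aut_pow_eq_add hc e)
  exact (mul_eq_zero.1 this).resolve_left (Nat.cast_ne_zero.2 (by omega))

/-! ### Isotropy groups -/

theorem delta_ofPoly (s f : k[X]) : (delta h s).1 (ofPoly h f) = 0 := by
  have hD := (delta h s).2
  have h1 : (delta h s).1 1 = 0 := by
    have := hD 1 1
    rw [mul_one, mul_one, one_mul] at this
    simpa using this
  induction f using Polynomial.induction_on' with
  | add p q hp hq => rw [map_add, map_add, hp, hq, add_zero]
  | monomial n c =>
    induction n with
    | zero => rw [monomial_zero_left, ofPoly_C, Algebra.algebraMap_eq_smul_one, map_smul, h1,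
        smul_zero]
    | succ n ih => rw [← monomial_mul_X, map_mul, ofPoly_X, hD, ih, delta_x, zero_mul, mul_zero,
        add_zero]

theorem innerDer_add_apply (w : A h) (D : Der k (A h)) (f : A h) :
    (innerDer w + D).1 f = w * f - f * w + D.1 f := rfl

theorem mem_isotropy {D : Der k (A h)} {ρ : A h ≃ₐ[k] A h} :
    ρ ∈ isotropy D ↔ ∀ f, ρ (D.1 f) = D.1 (ρ f) := Iff.rfl

theorem mem_isotropy_add_iff {w : A h} {D : Der k (A h)} {ρ : A h ≃ₐ[k] A h} (hw : ρ w = w) :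
    ρ ∈ isotropy (innerDer w + D) ↔ ρ ∈ isotropy D := by
  simp only [mem_isotropy, innerDer_add_apply, map_add, map_sub, map_mul, hw, add_right_inj]

theorem degree_comp_C_mul_X {a : k} (ha : a ≠ 0) (s : k[X]) :
    (s.comp (C a * X)).degree = s.degree := by
  rw [degree_comp (by rw [degree_C_mul_X ha]; exact zero_lt_one), degree_C_mul_X ha, mul_one]

/-- Evaluating the commutation relation at `x` puts `ρ(w) - w` in `k[x]`, and evaluating it at `t`
shows that `h` times the derivative of `ρ(w) - w` has degree less than that of `h`. -/
theorem exists_aut_sub_eq_algebraMap [CharZero k] (hdeg : 1 ≤ h.natDegree) {a : kˣ}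
    (ha : Scales h a) {ρ : A h ≃ₐ[k] A h} (hρ : ρ (x h) = (a : k) • x h) {w : A h} {s : k[X]}
    (hs : s.degree < h.degree) (hmem : ρ ∈ isotropy (innerDer w + delta h s)) :
    ∃ c, ρ w - w = algebraMap k (A h) c := by
  have h0 : h ≠ 0 := by rintro rfl; simp at hdeg
  rw [mem_isotropy] at hmem
  have ex := hmem (x h)
  rw [innerDer_add_apply, innerDer_add_apply, delta_x, hρ, map_smul, delta_x, smul_zero, add_zero,
    add_zero, map_sub, map_mul, map_mul, hρ, mul_smul_comm, smul_mul_assoc, mul_smul_comm,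
    smul_mul_assoc, ← smul_sub, ← smul_sub] at ex
  have ex1 := smul_right_injective _ a.ne_zero ex
  obtain ⟨g, hg⟩ := exists_eq_ofPoly_of_commute_x (w := ρ w - w) h0 (by
    rw [sub_mul, mul_sub, sub_eq_sub_iff_sub_eq_sub]
    exact ex1)
  obtain ⟨r, hr⟩ := exists_aut_t_eq h0 hdeg ha hρ
  have et := hmem (t h)
  rw [smul_x_eq_ofPoly] at hρ
  set β : k := (a : k) ^ (h.natDegree - 1) with hβ
  have hβ0 : β ≠ 0 := pow_ne_zero _ a.ne_zero
  rw [innerDer_add_apply, innerDer_add_apply, delta_t, map_add ρ, map_sub ρ, map_mul ρ, map_mul ρ,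
    sub_eq_iff_eq_add.1 hg, hr, map_add (delta h s).1, delta_ofPoly, add_zero, map_smul, delta_t,
    aut_ofPoly ρ hρ] at et
  have e3 : ofPoly h (C β * (h * derivative g)) = ofPoly h (s.comp (C (a : k) * X) - C β * s) := by
    have e4 : β • (t h * ofPoly h g - ofPoly h g * t h) = ofPoly h (C β * (h * derivative g)) := by
      rw [t_mul_ofPoly, add_sub_cancel_left, map_mul _ (C β), ofPoly_C, Algebra.smul_def]
    rw [← e4, map_sub, map_mul _ (C β) s, ofPoly_C, ← Algebra.smul_def]
    have e5 := ofPoly_mul_comm (h := h) g r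
    simp only [add_mul, mul_add, mul_smul_comm, smul_mul_assoc, smul_add] at et
    rw [e5] at et
    rw [smul_sub, sub_eq_sub_iff_add_eq_add]
    rw [← sub_eq_zero] at et ⊢
    rw [← neg_eq_zero, ← et]
    abel
  have e6 := ofPoly_injective e3
  have hg' : derivative g = 0 := by
    by_contra hne
    have hlt : (C β * (h * derivative g)).degree < h.degree := by
      rw [e6]
      refine (degree_sub_le _ _).trans_lt (max_lt ?_ ?_)
      · rwa [degree_comp_C_mul_X a.ne_zero]
      · rwa [degree_C_mul hβ0]
    rw [degree_C_mul hβ0] at hlt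
    exact absurd hlt (degree_le_mul_left h hne).not_gt
  refine ⟨g.coeff 0, ?_⟩
  rw [hg, ← ofPoly_C, ← eq_C_of_derivative_eq_zero hg']

theorem exists_sub_eq_iff_of_eq_zero {ρ : A h ≃ₐ[k] A h} {w : A h}
    (H : ∀ c, ρ w = w + algebraMap k (A h) c → c = 0) :
    (∃ c : k, ρ w - w = algebraMap k (A h) c) ↔ ρ w = w := by
  refine ⟨fun ⟨c, hc⟩ => ?_, fun hw => ⟨0, by rw [hw, sub_self, map_zero]⟩⟩
  have hc' : ρ w = w + algebraMap k (A h) c := by rw [← hc, add_sub_cancel]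
  rw [hc', H c hc', map_zero, add_zero]

theorem isotropy_delta_zero : isotropy (delta h 0) = ⊤ := by
  have hz : ∀ f, (delta h 0).1 f = 0 := by
    intro f
    have e : deltaHom h 0 = TrivSqZeroExt.inlAlgHom k (A h) (A h) := by
      apply hom_ext <;> simp [deltaHom, lift_x, lift_t]
    change ((deltaHom h 0) f).snd = 0
    rw [e]
    rfl
  refine eq_top_iff.2 fun ρ _ => mem_isotropy.2 fun f => ?_
  rw [hz, hz, map_zero]

end Field

end DiffOre

open DiffOre in
theorem mainTheorem6 {k : Type*} [Field k] [IsAlgClosed k] [CharZero k]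
    (h : k[X]) (hdeg : 1 ≤ h.natDegree) (hmonic : h.Monic)
    (hcoeff : h.coeff (h.natDegree - 1) = 0)
    (w : DiffOre.A h) (s : k[X]) (hs : s.degree < h.degree) :
    (2 ≤ DiffOre.degT h w →
      ∀ n : ℕ, 1 ≤ n →
        (DiffOre.isotropy (DiffOre.innerDer w + DiffOre.delta h s) : Set _)
            ⊆ DiffOre.polyRoots h n →
          ∀ ρ ∈ DiffOre.isotropy (DiffOre.innerDer w + DiffOre.delta h s),
            (∃ c : k, ρ w - w = algebraMap k (DiffOre.A h) c) ↔ ρ w = w) ∧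
    (2 ≤ h.natDegree →
      (¬ ∃ (α : k) (g : k[X]), α ≠ 0 ∧ w = α • DiffOre.t h + DiffOre.ofPoly h g) →
        (∀ ρ ∈ DiffOre.isotropy (DiffOre.innerDer w + DiffOre.delta h s),
          (∃ c : k, ρ w - w = algebraMap k (DiffOre.A h) c) ↔ ρ w = w) ∧
        DiffOre.isotropy (DiffOre.innerDer w + DiffOre.delta h s)
          = MulAction.stabilizer (DiffOre.A h ≃ₐ[k] DiffOre.A h) w
              ⊓ DiffOre.isotropy (DiffOre.delta h s) ∧
        (s = 0 →
          DiffOre.isotropy (DiffOre.innerDer w + DiffOre.delta h s)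
            = MulAction.stabilizer (DiffOre.A h ≃ₐ[k] DiffOre.A h) w)) := by
  
  have h0 := hmonic.ne_zero
  refine ⟨fun hw n hn hsub ρ hρ => ?_, fun hN hw => ?_⟩
  · obtain ⟨r, a, ha, han, rfl⟩ := hsub hρ
    have hx : (sigma h r * tau ha) (x h) = (a : k) • x h := by
      rw [AlgEquiv.mul_apply, tau_x, map_smul, sigma_x]
    refine exists_sub_eq_iff_of_eq_zero fun c hc => eq_zero_of_aut_eq_add hdeg ha hx
      (Or.inr ⟨n, hn, by rw [← Units.val_pow_eq_pow_val, han, Units.val_one]⟩) ?_ hc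
    rintro ⟨α, g, -, rfl⟩
    have e : α • t h + ofPoly h g = ofCoeffs h (C (C α) * X + C g) := by
      rw [map_add, ofCoeffs_C, ← ofPoly_mul_ofCoeffs, ofCoeffs_X, ofPoly_C, Algebra.smul_def]
    rw [e, degT_def, toCoeffs_ofCoeffs] at hw
    exact absurd (hw.trans degree_linear_le) (by decide)
  · have key : ∀ ρ : A h ≃ₐ[k] A h, (∃ c : k, ρ w - w = algebraMap k (A h) c) ↔ ρ w = w := by
      intro ρ
      obtain ⟨a, ha, hx⟩ := exists_aut_x_eq_smul hdeg hmonic hcoeff ρ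
      exact exists_sub_eq_iff_of_eq_zero fun c hc =>
        eq_zero_of_aut_eq_add hdeg ha hx (Or.inl hN) hw hc
    have heq : isotropy (innerDer w + delta h s)
        = MulAction.stabilizer (A h ≃ₐ[k] A h) w ⊓ isotropy (delta h s) := by
      ext ρ
      rw [Subgroup.mem_inf, MulAction.mem_stabilizer_iff, AlgEquiv.smul_def]
      refine ⟨fun hρ => ?_, fun ⟨hρ, hmem⟩ => (mem_isotropy_add_iff hρ).2 hmem⟩
      obtain ⟨a, ha, hx⟩ := exists_aut_x_eq_smul hdeg hmonic hcoeff ρ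
      have hρw := (key ρ).1 (exists_aut_sub_eq_algebraMap hdeg ha hx hs hρ)
      exact ⟨hρw, (mem_isotropy_add_iff hρw).1 hρ⟩
    refine ⟨fun ρ _ => key ρ, heq, ?_⟩
    rintro rfl
    rw [heq, isotropy_delta_zero, inf_top_eq]
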